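/- Let $(W,S)$ be a Coxeter system with Coxeter matrix $(m_{st})$ and let $A$ be the associated Artin group: it has generators $a_s$ ($s\in S$) and, for all $s\neq t$ with $m_{st}<\infty$, the relation $a_sa_ta_s\cdots=a_ta_sa_t\cdots$ with $m_{st}$ letters on each side. For $T\subseteq S$ let $W_T=\langle T\rangle\le W$; $T$ is spherical if $W_T$ is finite, and irreducible if the full subgraph on $T$ of the Coxeter diagram (in which $s\ne t$ are joined when $m_{st}>2$) is connected. The components of $T$ are the vertex sets of the connected components of this subgraph. Let $S_\oslash$ be the set of nonempty irreducible spherical subsets of $S$. Nested subsets of $S_\oslash$ are defined inductively: $\emptyset$ is nested, and $\alpha\subseteq S_\oslash$ is nested if its support $\operatorname{sp}(\alpha)=\bigcup_{T\in\alpha}T$ is spherical, the maximal elements $T_1,\dots,T_k$ of $\alpha$ are exactly the components of $\operatorname{sp}(\alpha)$, and each $\alpha_{<T_i}=\{T\in\alpha: T\subsetneq T_i\}$ is nested. The simplices of the complex $L_\oslash$ are the nested subsets of $S_\oslash$ (including the empty one). For $w\in W$ put $a_w=a_{s_1}\cdots a_{s_l}\in A$, where $s_1\cdots s_l$ is a reduced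 expression of $w$ (the choice does not matter). For spherical $T$ let $w_T$ be the longest element of $W_T$ and $\Delta_T=a_{w_T}$. For $T\in S_\oslash$ let $\delta_T=\Delta_T$ if $w_Ttw_T^{-1}=t$ for all $t\in T$, and $\delta_T=\Delta_T^2$ otherwise. For a simplex $\alpha$ of $L_\oslash$ the standard abelian subgroup $H_\alpha\le A$ is the subgroup generated by $\{\delta_T: T\in\alpha\}$ (so $H_\emptyset=1$). **Lemma.** If $\alpha$ and $\beta$ are simplices of $L_\oslash$, then $H_\alpha\cap H_\beta=H_{\alpha\cap\beta}$. -/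

import Mathlib

namespace ArtinComplex

universe u v

section CoxeterMatrixPart

/-- The Coxeter diagram of a Coxeter matrix, as a graph: `s` and `t` are joined when `m_st > 2`.
Mathlib writes `m_st = 0` for `m_st = ∞`, and `m_st = 1` happens only for `s = t`, so the condition
is `s ≠ t` and `m_st ≠ 2`. -/
def diagram {B : Type u} (M : CoxeterMatrix B) : SimpleGraph B where
  Adj s t := s ≠ t ∧ M s t ≠ 2
  symm := ⟨fun s t h => ⟨h.1.symm, by rw [M.symmetric t s]; exact h.2⟩⟩
  loopless := ⟨fun _ h => h.1 rfl⟩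

/-- The decomposition of `T` into irreducibles: the vertex sets of the connected components of
the full subdiagram spanned by `T`. -/
def components {B : Type u} (M : CoxeterMatrix B) (T : Set B) : Set (Set B) :=
  {T' | ∃ c : ((diagram M).induce T).ConnectedComponent, T' = Subtype.val '' c.supp}

/-- The Artin relators: for all `s`, `t` with `m_st` finite, the quotient of the two alternating
words of length `m_st` in `s` and `t`. For `s = t` the relator is trivial. -/
def artinRelators {B : Type u} (M : CoxeterMatrix B) : Set (FreeGroup B) :=
  {r | ∃ s t : B, M s t ≠ 0 ∧
    r = ((CoxeterSystem.braidWord M s t).map FreeGroup.of).prod *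
      (((CoxeterSystem.braidWord M t s).map FreeGroup.of).prod)⁻¹}

/-- The Artin group associated to a Coxeter matrix. -/
abbrev ArtinGroup {B : Type u} (M : CoxeterMatrix B) : Type u :=
  PresentedGroup (artinRelators M)

/-- The standard generator `a_s` of the Artin group. -/
def artinGen {B : Type u} (M : CoxeterMatrix B) (s : B) : ArtinGroup M :=
  PresentedGroup.of s

end CoxeterMatrixPart

section CoxeterSystemPart

/-- The special subgroup `W_T`, generated by `T`. -/
def specialSubgroup {B : Type u} {W : Type v} [Group W] {M : CoxeterMatrix B}
    (cs : CoxeterSystem M W) (T : Set B) : Subgroup W :=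
  Subgroup.closure (cs.simple '' T)

/-- `T` is spherical if `W_T` is finite. -/
def IsSpherical {B : Type u} {W : Type v} [Group W] {M : CoxeterMatrix B}
    (cs : CoxeterSystem M W) (T : Set B) : Prop :=
  (specialSubgroup cs T : Set W).Finite

/-- The set `S_⊘` of nonempty irreducible spherical subsets of `S`, the vertex set of `L_⊘`.
(A connected graph is nonempty by definition in Mathlib.) -/
def irreducibleSpherical {B : Type u} {W : Type v} [Group W] {M : CoxeterMatrix B}
    (cs : CoxeterSystem M W) : Set (Set B) :=
  {T | T.Nonempty ∧ IsSpherical cs T ∧ ((diagram M).induce T).Connected}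

/-- The support of a set of subsets of `S`: the union of its members. -/
def support {B : Type u} (α : Set (Set B)) : Set B := ⋃₀ α

/-- Nested subsets of `S_⊘`, defined inductively. The empty set is nested; `α ⊆ S_⊘` is nested
if its support is spherical, its maximal elements `T₁, …, T_k` are the decomposition
of the support into irreducibles, and each `α_{< T_i}` is nested. -/
inductive IsNested {B : Type u} {W : Type v} [Group W] {M : CoxeterMatrix B}
    (cs : CoxeterSystem M W) : Set (Set B) → Prop
  | empty : IsNested cs ∅
  | step (α : Set (Set B))
      (subset : α ⊆ irreducibleSpherical cs)
      (spherical : IsSpherical cs (support α))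
      (decomposition : {T | Maximal (fun T' => T' ∈ α) T} = components M (support α))
      (below : ∀ T, Maximal (fun T' => T' ∈ α) T → IsNested cs {T' | T' ∈ α ∧ T' ⊂ T}) :
      IsNested cs α

/-- The simplices of `L_⊘` (the empty simplex included), each given by its set of vertices. -/
def oslashSimplices {B : Type u} {W : Type v} [Group W] {M : CoxeterMatrix B}
    (cs : CoxeterSystem M W) : Set (Set (Set B)) :=
  {α | IsNested cs α}

/-- The element `a_w` of the Artin group: the product of the generators `a_s` along a reduced
expression of `w`. (By Tits and Matsumoto it does not depend on the expression that is chosen.) -/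
noncomputable def artinLift {B : Type u} {W : Type v} [Group W] {M : CoxeterMatrix B}
    (cs : CoxeterSystem M W) (w : W) : ArtinGroup M :=
  ((cs.exists_isReduced w).choose.map (artinGen M)).prod

/-- `w` is an element of longest length in `W_T`. (The length of an element of `W_T` with respect
to `T` agrees with its length in `W`.) -/
def IsLongest {B : Type u} {W : Type v} [Group W] {M : CoxeterMatrix B}
    (cs : CoxeterSystem M W) (T : Set B) (w : W) : Prop :=
  w ∈ specialSubgroup cs T ∧ ∀ v ∈ specialSubgroup cs T, cs.length v ≤ cs.length w

/-- A spherical `W_T` has an element of longest length (it is unique). -/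
theorem exists_isLongest {B : Type u} {W : Type v} [Group W] {M : CoxeterMatrix B}
    (cs : CoxeterSystem M W) {T : Set B} (hT : IsSpherical cs T) : ∃ w, IsLongest cs T w := by
  obtain ⟨w, hw, hmax⟩ := Set.exists_max_image (specialSubgroup cs T : Set W) cs.length hT
    ⟨1, (specialSubgroup cs T).one_mem⟩
  exact ⟨w, hw, hmax⟩

/-- The element `w_T` of longest length in `W_T`; meaningful for spherical `T`. -/
noncomputable def longest {B : Type u} {W : Type v} [Group W] {M : CoxeterMatrix B}
    (cs : CoxeterSystem M W) (T : Set B) : W :=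
  Classical.epsilon (IsLongest cs T)

theorem longest_spec {B : Type u} {W : Type v} [Group W] {M : CoxeterMatrix B}
    (cs : CoxeterSystem M W) {T : Set B} (hT : IsSpherical cs T) :
    IsLongest cs T (longest cs T) :=
  Classical.epsilon_spec (exists_isLongest cs hT)

/-- The element `Δ_T = a_{w_T}` of the Artin group. -/
noncomputable def bigDelta {B : Type u} {W : Type v} [Group W] {M : CoxeterMatrix B}
    (cs : CoxeterSystem M W) (T : Set B) : ArtinGroup M :=
  artinLift cs (longest cs T)

open Classical in
/-- For `T` irreducible and spherical: `δ_T = Δ_T` if conjugation by `w_T` fixes every element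
of `T`, and `δ_T = Δ_T ^ 2` otherwise. -/
noncomputable def smallDelta {B : Type u} {W : Type v} [Group W] {M : CoxeterMatrix B}
    (cs : CoxeterSystem M W) (T : Set B) : ArtinGroup M :=
  if ∀ t ∈ T, longest cs T * cs.simple t * (longest cs T)⁻¹ = cs.simple t then bigDelta cs T
  else bigDelta cs T ^ 2

/-- The standard abelian subgroup `H_α`, generated by the `δ_T` for `T` a vertex of `α`,
as a subgroup of the whole Artin group. -/
noncomputable def standardAbelian {B : Type u} {W : Type v} [Group W] {M : CoxeterMatrix B}
    (cs : CoxeterSystem M W) (α : Set (Set B)) : Subgroup (ArtinGroup M) :=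
  Subgroup.closure (smallDelta cs '' α)

end CoxeterSystemPart

end ArtinComplex

/-! The Artin group acts on `W × ℤ`: `a_s` conjugates the first coordinate by `s` and adds 1 to the
second when the first equals `s` (`crossingAction`). Over a reflection `r`, `Δ_T` adds 1 exactly
when `r ∈ W_T`, since a reduced word of `w_T` crosses each reflection of `W_T` once and no other. As
`w_T` is an involution, `Δ_T²` returns every `r` to itself. So `δ_T²` translates the fibre over `r`
by `κ_T` if `r ∈ W_T` and by 0 otherwise, with `κ_T` equal to 2 or 4. Squares are needed because
`Δ_T` itself may move `r`.

Members of a nested set are comparable or orthogonal, and `δ_T` is central in the parabolic subgroup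
of `T`, so the generators of `H_α` commute. An element `g` of `H_α ∩ H_β` is thus a product of
powers of the `δ_T` with exponents `a` supported in `α`, and also with exponents `b` supported in
`β`. The translations by `g²` give `∑ a_T κ_T [r ∈ W_T] = ∑ b_T κ_T [r ∈ W_T]` for every reflection
`r`. These indicators are linearly independent (`eq_zero_of_sum_indicator`), because an irreducible
spherical `T` has a reflection whose root has full support (`exists_isReflection_full_support`).
Hence `a = b` is supported in `α ∩ β`.

Strong exchange and Matsumoto's theorem let `Δ_T` be computed from any reduced word. -/

namespace ArtinComplex

open CoxeterSystem List

/-! ### Inversion counting and strong exchange. -/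

section Inversions

variable {B : Type*} {W : Type*} [Group W] {M : CoxeterMatrix B} (cs : CoxeterSystem M W)

open Classical in
/-- A generator `s` acts on `W × K` by conjugating the first coordinate, and the second coordinate
counts how often the first one equals `s`. -/
noncomputable def crossingPerm (K : Type*) [CommRing K] (s : B) : Equiv.Perm (W × K) where
  toFun p := (cs.simple s * p.1 * cs.simple s, p.2 + if p.1 = cs.simple s then 1 else 0)
  invFun p := (cs.simple s * p.1 * cs.simple s, p.2 - if p.1 = cs.simple s then 1 else 0)
  left_inv p := by
    have : cs.simple s * p.1 * cs.simple s = cs.simple s ↔ p.1 = cs.simple s := by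
      constructor
      · intro h
        have := congrArg (fun x => cs.simple s * x * cs.simple s) h
        simpa [mul_assoc] using this
      · rintro h; simp [h]
    ext
    · simp [mul_assoc]
    · simp only [this]; simp
  right_inv p := by
    have : cs.simple s * p.1 * cs.simple s = cs.simple s ↔ p.1 = cs.simple s := by
      constructor
      · intro h
        have := congrArg (fun x => cs.simple s * x * cs.simple s) h
        simpa [mul_assoc] using this
      · rintro h; simp [h]
    ext
    · simp [mul_assoc]
    · simp only [this]; simp

-- The letter `i` in front of `ω` scores exactly when the conjugate of `p.1` by `ω` is `s_i`, that
-- is, when `p.1` is the entry that `i` adds to the inversion sequence.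
open Classical in
theorem crossingPerm_prod_apply (K : Type*) [CommRing K] (ω : List B) (p : W × K) :
    (ω.map (crossingPerm cs K)).prod p =
      (cs.wordProd ω * p.1 * (cs.wordProd ω)⁻¹, p.2 + ((cs.rightInvSeq ω).count p.1 : K)) := by
  induction ω with
  | nil => simp
  | cons i ω ih =>
    have h : cs.wordProd ω * p.1 * (cs.wordProd ω)⁻¹ = cs.simple i ↔
        (cs.wordProd ω)⁻¹ * cs.simple i * cs.wordProd ω = p.1 := by
      constructor
      · intro h; rw [← h]; group
      · intro h; rw [← h]; group
    rw [List.map_cons, List.prod_cons, Equiv.Perm.mul_apply, ih]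
    simp only [crossingPerm, Equiv.coe_fn_mk, h, rightInvSeq, List.count_cons, beq_iff_eq,
      Nat.cast_add, add_assoc]
    simp only [wordProd_cons, mul_inv_rev, inv_simple, mul_assoc, Nat.cast_ite, Nat.cast_one,
      Nat.cast_zero]

theorem rightInvSeq_alternatingWord (i i' : B) (n : ℕ) :
    cs.rightInvSeq (alternatingWord i i' n) =
      ((List.range n).map
        (fun k => (cs.simple i' * cs.simple i) ^ k * cs.simple i')).reverse := by
  induction n with
  | zero => simp [alternatingWord]
  | succ n ih =>
    rw [alternatingWord_succ', rightInvSeq, ih, List.range_succ, List.map_append,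
      List.reverse_append]
    simp only [List.map_cons, List.map_nil, List.reverse_cons, List.reverse_nil, List.nil_append,
      List.cons_append, List.cons.injEq, and_true]
    rw [prod_alternatingWord_eq_mul_pow]
    have hinv : ∀ k : ℕ, ((cs.simple i * cs.simple i') ^ k)⁻¹ =
        (cs.simple i' * cs.simple i) ^ k := by
      intro k; rw [← inv_pow]; simp
    have hcomm : ∀ k : ℕ, cs.simple i' * (cs.simple i * cs.simple i') ^ k =
        (cs.simple i' * cs.simple i) ^ k * cs.simple i' := by
      intro k
      induction k with
      | zero => simp
      | succ k ih => rw [pow_succ, ← mul_assoc, ih, pow_succ]; simp only [mul_assoc]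
    rcases Nat.even_or_odd' n with ⟨k, rfl | rfl⟩
    · simp only [even_two, Even.mul_right, ↓reduceIte, one_mul, ne_eq, OfNat.ofNat_ne_zero,
        not_false_eq_true, mul_div_cancel_left₀, hinv]
      rw [mul_assoc, hcomm, ← mul_assoc, ← pow_add, two_mul]
    · have h1 : ¬ Even (2 * k + 1) := by simp
      have h2 : (2 * k + 1) / 2 = k := by omega
      simp only [h1, if_false, h2, mul_inv_rev, hinv, inv_simple]
      have : (cs.simple i' * cs.simple i) ^ (2 * k + 1) * cs.simple i' =
          (cs.simple i' * cs.simple i) ^ k * (cs.simple i' * cs.simple i) *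
            ((cs.simple i' * cs.simple i) ^ k * cs.simple i') := by
        rw [← mul_assoc, ← pow_succ, ← pow_add]; congr 2; omega
      rw [this, ← hcomm]
      simp only [mul_assoc]
      rw [← mul_assoc (cs.simple i'), hcomm]
      simp only [mul_assoc]

open Classical in
theorem count_rightInvSeq_alternatingWord (i i' : B) (n : ℕ) (r : W) :
    (cs.rightInvSeq (alternatingWord i i' n)).count r =
      ∑ k ∈ Finset.range n,
        if (cs.simple i' * cs.simple i) ^ k * cs.simple i' = r then 1 else 0 := by
  rw [rightInvSeq_alternatingWord, List.count_reverse]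
  induction n with
  | zero => simp
  | succ n ih =>
    rw [List.range_succ, List.map_append, List.count_append, ih, Finset.sum_range_succ]
    simp [List.count_cons]

-- The substitution `k ↦ m - 1 - k` exchanges the two lists of dihedral reflections, because
-- `(s_{i'} s_i)^m = 1`. When `m = 0` both lists are empty.
open Classical in
theorem count_rightInvSeq_braidWord (i i' : B) (r : W) :
    (cs.rightInvSeq (braidWord M i i')).count r = (cs.rightInvSeq (braidWord M i' i)).count r := by
  rw [braidWord, braidWord, count_rightInvSeq_alternatingWord, count_rightInvSeq_alternatingWord,
    M.symmetric i' i, ← Finset.sum_range_reflect]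
  refine Finset.sum_congr rfl fun k hk => ?_
  have hk : k < M i i' := Finset.mem_range.mp hk
  have h : (cs.simple i' * cs.simple i) ^ (M i i' - 1 - k) * cs.simple i' =
      (cs.simple i * cs.simple i') ^ k * cs.simple i := by
    have h1 : (cs.simple i * cs.simple i') ^ k = ((cs.simple i' * cs.simple i) ^ k)⁻¹ := by
      rw [← inv_pow]; simp
    have h2 : (cs.simple i' * cs.simple i) ^ (M i i' - 1 - k) *
        (cs.simple i' * cs.simple i) * (cs.simple i' * cs.simple i) ^ k = 1 := by
      rw [← pow_succ, ← pow_add]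
      rw [show M i i' - 1 - k + 1 + k = M i i' by omega]
      exact cs.simple_mul_simple_pow' i i'
    rw [h1, ← mul_eq_one_iff_eq_inv.mp h2]
    simp [mul_assoc]
  rw [h]

theorem crossingPerm_braid (K : Type*) [CommRing K] (i i' : B) :
    ((braidWord M i i').map (crossingPerm cs K)).prod =
      ((braidWord M i' i).map (crossingPerm cs K)).prod := by
  classical
  ext1 p
  rw [crossingPerm_prod_apply, crossingPerm_prod_apply, cs.wordProd_braidWord_eq,
    count_rightInvSeq_braidWord]

theorem prod_map_alternatingWord_two_mul {G : Type*} [Monoid G] (f : B → G) (i i' : B) (k : ℕ) :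
    ((alternatingWord i i' (2 * k)).map f).prod = (f i * f i') ^ k := by
  induction k with
  | zero => simp [alternatingWord]
  | succ k ih =>
    rw [show 2 * (k + 1) = 2 * k + 1 + 1 by ring, alternatingWord_succ, alternatingWord_succ]
    simp [ih, pow_succ]

/-- A word `(i i')^m` meets each of its reflections an even number of times, so the count dies
modulo 2. Over `ℤ` only the braid relations survive, which is why `ℤ` serves the Artin group and
`ZMod 2` serves `W`. -/
theorem crossingPerm_isLiftable : M.IsLiftable (crossingPerm cs (ZMod 2)) := by
  classical
  intro i i'
  rw [← prod_map_alternatingWord_two_mul]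
  ext1 p
  rw [crossingPerm_prod_apply, count_rightInvSeq_alternatingWord, two_mul, Finset.sum_range_add]
  have h : ∀ k, (cs.simple i' * cs.simple i) ^ (M i i' + k) = (cs.simple i' * cs.simple i) ^ k := by
    intro k; rw [pow_add, cs.simple_mul_simple_pow', one_mul]
  simp only [h]
  have h2 : cs.wordProd (alternatingWord i i' (M i i' + M i i')) = 1 := by
    rw [← two_mul]
    have := prod_map_alternatingWord_two_mul cs.simple i i' (M i i')
    rw [cs.simple_mul_simple_pow] at this
    exact this
  rw [h2, ← two_mul]
  ext
  · simp
  · simp only [Nat.cast_mul, Equiv.Perm.coe_one, id_eq]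
    rw [show ((2 : ℕ) : ZMod 2) = 0 from rfl]; simp

/-- The permutation action of `W` on `W × ℤ/2` that counts inversions modulo `2`. -/
noncomputable def parityAction : W →* Equiv.Perm (W × ZMod 2) :=
  cs.lift ⟨_, crossingPerm_isLiftable cs⟩

open Classical in
theorem parityAction_wordProd (ω : List B) (p : W × ZMod 2) :
    parityAction cs (cs.wordProd ω) p =
      (cs.wordProd ω * p.1 * (cs.wordProd ω)⁻¹,
        p.2 + ((cs.rightInvSeq ω).count p.1 : ZMod 2)) := by
  rw [← crossingPerm_prod_apply, wordProd, map_list_prod, List.map_map]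
  congr 3
  ext1 i
  exact cs.lift_apply_simple (crossingPerm_isLiftable cs) i

/-- The parity of the number of occurrences of `r` in the right inversion sequence of any word
for `w`. -/
noncomputable def inversionParity (w r : W) : ZMod 2 := (parityAction cs w (r, 0)).2

theorem parityAction_apply (w : W) (p : W × ZMod 2) :
    parityAction cs w p = (w * p.1 * w⁻¹, p.2 + inversionParity cs w p.1) := by
  obtain ⟨ω, rfl⟩ := cs.wordProd_surjective w
  simp [inversionParity, parityAction_wordProd]

open Classical in
theorem inversionParity_wordProd (ω : List B) (r : W) :
    inversionParity cs (cs.wordProd ω) r = ((cs.rightInvSeq ω).count r : ZMod 2) := by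
  simp [inversionParity, parityAction_wordProd]

theorem inversionParity_mul (w w' r : W) :
    inversionParity cs (w * w') r =
      inversionParity cs w' r + inversionParity cs w (w' * r * w'⁻¹) := by
  have := congrArg Prod.snd (parityAction_apply cs (w * w') (r, 0))
  rw [map_mul, Equiv.Perm.mul_apply, parityAction_apply, parityAction_apply] at this
  simpa using this.symm

theorem inversionParity_self {t : W} (ht : cs.IsReflection t) : inversionParity cs t t = 1 := by
  classical
  obtain ⟨w, i, rfl⟩ := ht
  have h1 : inversionParity cs (w * w⁻¹) (w * cs.simple i * w⁻¹) = 0 := by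
    simpa using inversionParity_wordProd cs [] (w * cs.simple i * w⁻¹)
  have h2 : inversionParity cs (cs.simple i) (cs.simple i) = 1 := by
    simpa using inversionParity_wordProd cs [i] (cs.simple i)
  rw [inversionParity_mul] at h1
  rw [inversionParity_mul, inversionParity_mul]
  have e : w⁻¹ * (w * cs.simple i * w⁻¹) * w⁻¹⁻¹ = cs.simple i := by group
  rw [e] at h1 ⊢
  simp only [mul_inv_cancel_right, h2]
  linear_combination h1

theorem mem_rightInvSeq_of_inversionParity {ω : List B} {t : W}
    (h : inversionParity cs (cs.wordProd ω) t = 1) : t ∈ cs.rightInvSeq ω := by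
  classical
  rw [inversionParity_wordProd] at h
  by_contra hn
  rw [List.count_eq_zero_of_not_mem hn] at h
  simp at h

/-- Odd parity puts `t` in the inversion sequence of a reduced word. Conversely, even parity for `w`
means odd parity for `w * t` by the cocycle rule, so `t` would shorten `w * t` instead of `w`. -/
theorem isRightInversion_iff_inversionParity {w t : W} (ht : cs.IsReflection t) :
    cs.IsRightInversion w t ↔ inversionParity cs w t = 1 := by
  have of_parity : ∀ w, inversionParity cs w t = 1 → cs.IsRightInversion w t := by
    intro w h
    obtain ⟨ω, hω, rfl⟩ := cs.exists_isReduced w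
    exact cs.isRightInversion_of_mem_rightInvSeq hω (mem_rightInvSeq_of_inversionParity cs h)
  refine ⟨fun h => ?_, of_parity w⟩
  have hz : ∀ x : ZMod 2, x = 0 ∨ x = 1 := by decide
  refine (hz _).resolve_left fun h0 => ?_
  refine ht.isRightInversion_mul_left_iff.mp (of_parity (w * t) ?_) h
  rw [inversionParity_mul, inversionParity_self cs ht, mul_inv_cancel_right, h0, add_zero]

/-- The strong exchange property. -/
theorem mem_rightInvSeq_of_isRightInversion {ω : List B} {t : W}
    (h : cs.IsRightInversion (cs.wordProd ω) t) : t ∈ cs.rightInvSeq ω :=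
  mem_rightInvSeq_of_inversionParity cs ((isRightInversion_iff_inversionParity cs h.1).mp h)

theorem mem_rightInvSeq_iff {ω : List B} (hω : cs.IsReduced ω) {t : W} :
    t ∈ cs.rightInvSeq ω ↔ cs.IsRightInversion (cs.wordProd ω) t :=
  ⟨cs.isRightInversion_of_mem_rightInvSeq hω, mem_rightInvSeq_of_isRightInversion cs⟩

theorem exists_eraseIdx_of_isRightDescent {ω : List B} {i : B}
    (h : cs.IsRightDescent (cs.wordProd ω) i) :
    ∃ j < ω.length, cs.wordProd ω * cs.simple i = cs.wordProd (ω.eraseIdx j) := by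
  rw [← cs.isRightInversion_simple_iff_isRightDescent] at h
  obtain ⟨j, hj, he⟩ := List.mem_iff_getElem.mp (mem_rightInvSeq_of_isRightInversion cs h)
  refine ⟨j, by simpa using hj, ?_⟩
  rw [← he, ← cs.wordProd_mul_getD_rightInvSeq, List.getD_eq_getElem _ 1 hj]

end Inversions

end ArtinComplex

namespace ArtinComplex

open CoxeterSystem

/-! ### The geometric representation and supports of roots. -/

section GeometricRepresentation

variable {B : Type*} (M : CoxeterMatrix B)

/-- The coroot of `s` in the geometric representation. -/
noncomputable def coroot (s : B) : Module.Dual ℝ (B →₀ ℝ) :=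
  Finsupp.linearCombination ℝ fun t => -2 * Real.cos (Real.pi / M s t)

theorem coroot_single (s t : B) (c : ℝ) :
    coroot M s (Finsupp.single t c) = c * (-2 * Real.cos (Real.pi / M s t)) := by
  simp [coroot]

theorem coroot_single_self (s : B) : coroot M s (Finsupp.single s 1) = 2 := by
  simp [coroot_single]

/-- The simple reflection of the geometric representation. -/
noncomputable def geomReflection (s : B) : (B →₀ ℝ) ≃ₗ[ℝ] (B →₀ ℝ) :=
  Module.reflection (coroot_single_self M s)

theorem geomReflection_apply (s : B) (v : B →₀ ℝ) :
    geomReflection M s v = v - coroot M s v • Finsupp.single s 1 :=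
  Module.reflection_apply v (coroot_single_self M s)

theorem coroot_mul_coroot_sub_two (s t : B) :
    coroot M s (Finsupp.single t 1) * coroot M t (Finsupp.single s 1) - 2 =
      2 * Real.cos (2 * Real.pi / M s t) := by
  rw [coroot_single, coroot_single, M.symmetric t s, mul_div_assoc, Real.cos_two_mul]
  ring

theorem eval_S_eq {θ : ℝ} (h : Real.sin θ ≠ 0) (n : ℤ) :
    (Polynomial.Chebyshev.S ℝ n).eval (2 * Real.cos θ) = Real.sin ((n + 1) * θ) / Real.sin θ := by
  rw [eq_div_iff h, Polynomial.Chebyshev.S_two_mul_real_cos]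

theorem sin_two_pi_div_pos {m : ℕ} (hm : 3 ≤ m) : 0 < Real.sin (2 * Real.pi / m) := by
  have hm' : (3 : ℝ) ≤ m := by exact_mod_cast hm
  have hp := Real.pi_pos
  apply Real.sin_pos_of_pos_of_lt_pi
  · positivity
  · rw [div_lt_iff₀ (by linarith)]; nlinarith

theorem geomReflection_isLiftable : M.IsLiftable (geomReflection M) := by
  intro s t
  by_cases hst : s = t
  · subst hst
    rw [M.diagonal, pow_one]
    ext1 v
    exact Module.involutive_reflection (coroot_single_self M s) v
  have h1 := M.off_diagonal s t hst
  obtain h0 | h2 | h3 : M s t = 0 ∨ M s t = 2 ∨ 3 ≤ M s t := by omega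
  · rw [h0, pow_zero]
  · have hs : coroot M s (Finsupp.single t 1) = 0 := by simp [coroot_single, h2]
    have ht : coroot M t (Finsupp.single s 1) = 0 := by simp [coroot_single, M.symmetric t s, h2]
    rw [h2, pow_two]
    ext1 v
    simp only [LinearEquiv.mul_apply, geomReflection_apply, map_sub, map_smul, hs, ht,
      coroot_single_self, LinearEquiv.coe_one, id_eq]
    module
  · ext1 v
    have hsin := (sin_two_pi_div_pos h3).ne'
    have hm : (M s t : ℝ) ≠ 0 := by positivity
    have key := Module.reflection_mul_reflection_pow_apply (coroot_single_self M s)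
      (coroot_single_self M t) (M s t) v
    rw [coroot_mul_coroot_sub_two] at key
    simp only [eval_S_eq hsin] at key
    rw [geomReflection, geomReflection, key]
    -- With `θ = 2π/m`, the Chebyshev values are `sin((n+1)θ)/sin θ`. For `m = 2k` the factors
    -- contain `sin(kθ) = sin π = 0`; for `m = 2k+1` they cancel in pairs since `kθ + (k+1)θ = 2π`.
    rcases Nat.even_or_odd' (M s t) with ⟨k, hk | hk⟩
    · have e1 : ((M s t : ℤ) - 2) / 2 = k - 1 := by omega
      have e2 : ((M s t : ℤ) - 1) / 2 = k - 1 := by omega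
      have hs : Real.sin ((((k - 1 : ℤ) : ℝ) + 1) * (2 * Real.pi / M s t)) = 0 := by
        have : (((k - 1 : ℤ) : ℝ) + 1) * (2 * Real.pi / M s t) = Real.pi := by
          have hk0 : (k : ℝ) ≠ 0 := by rintro h; simp [hk, h] at hm
          rw [hk]
          push_cast
          field_simp
          ring
        rw [this, Real.sin_pi]
      simp only [e1, e2, hs]
      simp
    · have e1 : ((M s t : ℤ) - 1) / 2 = k := by omega
      have e2 : ((M s t : ℤ) - 3) / 2 = k - 1 := by omega
      have e3 : ((M s t : ℤ)) / 2 = k := by omega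
      have e4 : ((M s t : ℤ) - 2) / 2 = k - 1 := by omega
      have hs : Real.sin ((((k - 1 : ℤ) : ℝ) + 1) * (2 * Real.pi / M s t)) =
          - Real.sin ((((k : ℤ) : ℝ) + 1) * (2 * Real.pi / M s t)) := by
        have : (((k : ℤ) : ℝ) + 1) * (2 * Real.pi / M s t) = 2 * Real.pi -
            (((k - 1 : ℤ) : ℝ) + 1) * (2 * Real.pi / M s t) := by
          rw [hk] at hm ⊢
          push_cast at hm ⊢
          field_simp
          ring
        rw [this, Real.sin_two_pi_sub, neg_neg]
      simp only [e1, e2, e3, e4, hs]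
      simp [neg_div]

variable {M} {W : Type*} [Group W] (cs : CoxeterSystem M W)

/-- The geometric representation of a Coxeter group. -/
noncomputable def geomRep : W →* ((B →₀ ℝ) ≃ₗ[ℝ] (B →₀ ℝ)) :=
  cs.lift ⟨_, geomReflection_isLiftable M⟩

theorem geomRep_simple (s : B) : geomRep cs (cs.simple s) = geomReflection M s :=
  cs.lift_apply_simple (geomReflection_isLiftable M) s

/-- The geometric representation shows that `s t` has order exactly `m`. If its `k`-th power fixes
the root of `s`, then for `m ≥ 3` the `t`-coordinate gives `sin(kθ) = 0` and the `s`-coordinate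
`cos(kθ) = 1`, where `θ = 2π/m`. This is impossible for `0 < kθ < 2π`. -/
theorem simple_mul_simple_pow_ne_one {s t : B} (hst : s ≠ t) {k : ℕ} (hk : 0 < k)
    (hkm : M s t = 0 ∨ k < M s t) : (cs.simple s * cs.simple t) ^ k ≠ 1 := by
  intro h
  have h1 := M.off_diagonal s t hst
  have key := Module.reflection_mul_reflection_pow_apply_self (coroot_single_self M s)
      (coroot_single_self M t) k
  rw [coroot_mul_coroot_sub_two] at key
  have h' : (Module.reflection (coroot_single_self M s) *
      Module.reflection (coroot_single_self M t)) ^ k = 1 := by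
    have := congrArg (geomRep cs) h
    rwa [map_pow, map_mul, geomRep_simple, geomRep_simple, map_one] at this
  rw [h'] at key
  have ks := DFunLike.congr_fun key s
  have kt := DFunLike.congr_fun key t
  simp only [LinearEquiv.coe_one, id_eq, Finsupp.single_eq_same, Finsupp.coe_add,
    Finsupp.coe_smul, Pi.add_apply, Pi.smul_apply, smul_eq_mul, mul_one, mul_neg,
    Finsupp.single_eq_of_ne hst, Finsupp.single_eq_of_ne hst.symm, mul_zero, add_zero,
    zero_add, coroot_single, one_mul] at ks kt
  have hk' : (0 : ℝ) < k := by exact_mod_cast hk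
  obtain h0 | h2 | h3 : M s t = 0 ∨ M s t = 2 ∨ 3 ≤ M s t := by omega
  -- Here `π / 0 = 0`, so the cosines are 1 and the Chebyshev value `S_{k-1}(2) = k` is nonzero.
  · simp [M.symmetric t s, h0] at kt
    omega
  · obtain rfl : k = 1 := by omega
    have : 2 * Real.pi / (M s t : ℝ) = Real.pi := by rw [h2]; push_cast; field_simp
    rw [this] at ks
    simp at ks
  · have hkm : k < M s t := by omega
    have hkm' : (k : ℝ) < M s t := by exact_mod_cast hkm
    have hm' : (3 : ℝ) ≤ M s t := by exact_mod_cast h3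
    have hm : (M s t : ℝ) ≠ 0 := by positivity
    have hp := Real.pi_pos
    have hsin := sin_two_pi_div_pos h3
    have hcos : Real.cos (Real.pi / M s t) ≠ 0 := by
      refine (Real.cos_pos_of_mem_Ioo ⟨?_, ?_⟩).ne'
      · have : 0 < Real.pi / M s t := by positivity
        linarith
      · apply div_lt_div_of_pos_left hp <;> linarith
    rw [M.symmetric t s] at kt
    simp only [eval_S_eq hsin.ne'] at ks kt
    push_cast at ks kt
    have hz : Real.sin (k * (2 * Real.pi / M s t)) = 0 := by
      have : (k : ℝ) - 1 + 1 = k := by ring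
      rw [this] at kt
      simpa [hcos, hsin.ne'] using kt
    rw [sub_add_cancel, hz, zero_div, add_zero, eq_div_iff hsin.ne', one_mul, add_mul, one_mul,
      Real.sin_add, hz, zero_mul, zero_add] at ks
    have hc : Real.cos (k * (2 * Real.pi / M s t)) = 1 := by
      have := mul_right_cancel₀ hsin.ne' ((one_mul _).trans ks)
      exact this.symm
    rw [Real.cos_eq_one_iff_of_lt_of_lt] at hc
    · have : 0 < (k : ℝ) * (2 * Real.pi / M s t) := by positivity
      linarith
    · have : 0 < (k : ℝ) * (2 * Real.pi / M s t) := by positivity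
      linarith
    · rw [← mul_div_assoc, div_lt_iff₀ (by linarith)]
      nlinarith

theorem simple_injective : Function.Injective cs.simple := by
  intro s t h
  by_contra hst
  have h1 := M.off_diagonal s t hst
  refine simple_mul_simple_pow_ne_one cs hst one_pos (by omega) ?_
  simp [h]

theorem geomRep_sub_mem_supported {T : Set B} {w : W} (hw : w ∈ specialSubgroup cs T)
    (v : B →₀ ℝ) : geomRep cs w v - v ∈ Finsupp.supported ℝ ℝ T := by
  induction hw using Subgroup.closure_induction generalizing v with
  | mem x hx =>
    obtain ⟨s, hs, rfl⟩ := hx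
    rw [geomRep_simple, geomReflection_apply, sub_sub_cancel_left]
    exact Submodule.neg_mem _ (Submodule.smul_mem _ _ (Finsupp.single_mem_supported ℝ _ hs))
  | one => simp
  | mul x y _ _ hx hy =>
    have := Submodule.add_mem _ (hx (geomRep cs y v)) (hy v)
    simpa using this
  | inv x _ hx =>
    have := Submodule.neg_mem _ (hx (geomRep cs x⁻¹ v))
    simpa [← LinearEquiv.mul_apply, ← map_mul] using this

/-- A reflection whose root is `v` lies only in those special subgroups `W_T` for which `T` contains
the support of `v`. -/
theorem support_root_subset {T : Set B} {w : W} {s : B}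
    (h : w * cs.simple s * w⁻¹ ∈ specialSubgroup cs T) :
    ((geomRep cs w (Finsupp.single s 1)).support : Set B) ⊆ T := by
  have h1 := geomRep_sub_mem_supported cs h (geomRep cs w (Finsupp.single s 1))
  have h2 : geomRep cs (w * cs.simple s * w⁻¹) (geomRep cs w (Finsupp.single s 1)) =
      - geomRep cs w (Finsupp.single s 1) := by
    rw [← LinearEquiv.mul_apply, ← map_mul, inv_mul_cancel_right, map_mul, LinearEquiv.mul_apply,
      geomRep_simple, geomReflection_apply, coroot_single_self, ← map_neg]
    congr 1
    module
  -- A reflection negates its root, so the root is a multiple of a displacement, and displacements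
  -- by `W_T` are supported in `T`.
  rw [h2, show ∀ x : B →₀ ℝ, -x - x = (-2 : ℝ) • x from fun x => by module] at h1
  have h3 := Submodule.smul_mem _ (-2 : ℝ)⁻¹ h1
  rw [smul_smul, inv_mul_cancel₀ (by norm_num), one_smul] at h3
  exact (Finsupp.mem_supported ℝ _).mp h3

theorem coroot_single_nonpos {s t : B} (hst : s ≠ t) : coroot M s (Finsupp.single t 1) ≤ 0 := by
  have h1 := M.off_diagonal s t hst
  have hp := Real.pi_pos
  rw [coroot_single]
  have : 0 ≤ Real.cos (Real.pi / M s t) := by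
    rcases Nat.eq_zero_or_pos (M s t) with h | h
    · simp [h]
    · have h2 : (2 : ℝ) ≤ M s t := by exact_mod_cast (by omega : 2 ≤ M s t)
      apply Real.cos_nonneg_of_neg_pi_div_two_le_of_le
      · have : 0 < Real.pi / M s t := by positivity
        linarith
      · apply div_le_div_of_nonneg_left <;> linarith
  linarith

theorem coroot_single_neg {s t : B} (hst : (diagram M).Adj s t) :
    coroot M s (Finsupp.single t 1) < 0 := by
  have h1 := M.off_diagonal s t hst.1
  have h2 := hst.2
  have hp := Real.pi_pos
  rw [coroot_single]
  have : 0 < Real.cos (Real.pi / M s t) := by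
    rcases Nat.eq_zero_or_pos (M s t) with h | h
    · simp [h]
    · have h2 : (3 : ℝ) ≤ M s t := by exact_mod_cast (by omega : 3 ≤ M s t)
      apply Real.cos_pos_of_mem_Ioo
      constructor
      · have : 0 < Real.pi / M s t := by positivity
        linarith
      · apply div_lt_div_of_pos_left <;> linarith
  linarith

/-- Off-diagonal coroot values are nonpositive, and negative along an edge. So the coroot of `b` is
negative on `v`, and reflecting in `b` adds a positive multiple of the root of `b` without changing
the other coordinates. -/
theorem exists_root_support_insert {T : Set B} {v : B →₀ ℝ} (hv : ∀ x, 0 ≤ v x)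
    {w : W} {s : B} (hw : w ∈ specialSubgroup cs T) (hvw : geomRep cs w (Finsupp.single s 1) = v)
    {a b : B} (ha : a ∈ v.support) (hb : b ∉ v.support) (hbT : b ∈ T)
    (hab : (diagram M).Adj b a) :
    ∃ w' ∈ specialSubgroup cs T, (∀ x, 0 ≤ geomRep cs w' (Finsupp.single s 1) x) ∧
      insert b (v.support : Set B) ⊆ (geomRep cs w' (Finsupp.single s 1)).support := by
  have hneg : coroot M b v < 0 := by
    rw [← Finsupp.sum_single v, map_finsuppSum, Finsupp.sum]
    have h1 : ∀ x, coroot M b (Finsupp.single x (v x)) = v x * coroot M b (Finsupp.single x 1) := by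
      intro x; rw [coroot_single, coroot_single, one_mul]
    simp only [h1]
    apply Finset.sum_neg'
    · intro x hx
      refine mul_nonpos_of_nonneg_of_nonpos (hv x) (coroot_single_nonpos ?_)
      rintro rfl; exact hb hx
    · refine ⟨a, ha, mul_neg_of_pos_of_neg ?_ (coroot_single_neg hab)⟩
      exact lt_of_le_of_ne (hv a) (Finsupp.mem_support_iff.mp ha).symm
  have hval : ∀ x, geomRep cs (cs.simple b * w) (Finsupp.single s 1) x =
      v x - coroot M b v * Finsupp.single b 1 x := by
    intro x
    rw [map_mul, LinearEquiv.mul_apply, hvw, geomRep_simple, geomReflection_apply,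
      Finsupp.sub_apply, Finsupp.smul_apply, smul_eq_mul]
  have hsingle : ∀ x, (0 : ℝ) ≤ Finsupp.single b (1 : ℝ) x := by
    classical
    intro x; rw [Finsupp.single_apply]; split_ifs <;> norm_num
  refine ⟨cs.simple b * w, mul_mem (Subgroup.subset_closure ⟨b, hbT, rfl⟩) hw, ?_, ?_⟩
  · intro x
    rw [hval]
    nlinarith [hv x, hsingle x]
  · intro x hx
    rw [Finset.mem_coe, Finsupp.mem_support_iff, hval]
    rcases hx with rfl | hx
    · rw [Finsupp.notMem_support_iff.mp hb]
      simp [hneg.ne]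
    · have : 0 < v x := lt_of_le_of_ne (hv x) (Finsupp.mem_support_iff.mp hx).symm
      nlinarith [hv x, hsingle x]

/-- An irreducible finite special subgroup contains a reflection that lies in no smaller special
subgroup. -/
theorem exists_isReflection_full_support {T : Set B} (hfin : T.Finite)
    (hT : ((diagram M).induce T).Connected) :
    ∃ r ∈ specialSubgroup cs T, cs.IsReflection r ∧
      ∀ T', r ∈ specialSubgroup cs T' → T ⊆ T' := by
  obtain ⟨s, hs⟩ := hT.nonempty
  let F : Set (Set B) := {X | ∃ w ∈ specialSubgroup cs T,
    (∀ x, 0 ≤ geomRep cs w (Finsupp.single s 1) x) ∧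
      X = (geomRep cs w (Finsupp.single s 1)).support}
  have hsup : ∀ X ∈ F, X ⊆ T := by
    rintro X ⟨w, hw, -, rfl⟩
    exact support_root_subset cs (mul_mem (mul_mem hw (Subgroup.subset_closure ⟨s, hs, rfl⟩))
      (inv_mem hw))
  have hne : F.Nonempty := by
    refine ⟨_, 1, one_mem _, fun x => ?_, rfl⟩
    classical
    rw [map_one, LinearEquiv.coe_one, id_eq, Finsupp.single_apply]; split_ifs <;> norm_num
  obtain ⟨X, ⟨⟨w, hw, hpos, hX⟩, hmax⟩⟩ :=
    (hfin.finite_subsets.subset hsup).exists_maximal hne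
  have hXne : X.Nonempty := by
    rw [hX, Finset.coe_nonempty, Finsupp.support_nonempty_iff]
    simp
  have hXT : X = T := by
    refine (hsup X ⟨w, hw, hpos, hX⟩).antisymm fun b hb => ?_
    by_contra hbX
    obtain ⟨a, ha⟩ := hXne
    have haT : a ∈ T := hsup X ⟨w, hw, hpos, hX⟩ ha
    -- By connectedness some edge leaves the maximal support; reflecting at its outer end enlarges
    -- the support.
    obtain ⟨p⟩ := hT.preconnected ⟨a, haT⟩ ⟨b, hb⟩
    obtain ⟨d, -, hd1, hd2⟩ := p.exists_boundary_dart (Subtype.val ⁻¹' X) ha hbX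
    have hadj : (diagram M).Adj d.snd d.fst := d.adj.symm
    subst hX
    obtain ⟨w', hw', hp', hsub⟩ := exists_root_support_insert cs hpos hw rfl hd1 hd2 d.snd.2 hadj
    exact hd2 (hmax ⟨w', hw', hp', rfl⟩ ((Set.subset_insert _ _).trans hsub)
      (hsub (Set.mem_insert _ _)))
  refine ⟨w * cs.simple s * w⁻¹, mul_mem (mul_mem hw (Subgroup.subset_closure ⟨s, hs, rfl⟩))
      (inv_mem hw), ⟨w, s, rfl⟩, fun T' h => ?_⟩
  rw [← hXT, hX]
  exact support_root_subset cs h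

end GeometricRepresentation

end ArtinComplex

namespace ArtinComplex

open CoxeterSystem

/-! ### Matsumoto's theorem. -/

section Matsumoto

variable {B : Type*} {W : Type*} [Group W] {M : CoxeterMatrix B} (cs : CoxeterSystem M W)

theorem simple_notMem_rightInvSeq_alternatingWord {i i' : B} (hne : i ≠ i') {k : ℕ}
    (hk : M i i' = 0 ∨ k < M i i') :
    cs.simple i ∉ cs.rightInvSeq (alternatingWord i i' k) := by
  rw [rightInvSeq_alternatingWord, List.mem_reverse, List.mem_map]
  rintro ⟨j, hj, he⟩
  rw [List.mem_range] at hj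
  refine simple_mul_simple_pow_ne_one cs hne.symm (Nat.succ_pos j) ?_ ?_
  · rw [M.symmetric i' i]; omega
  · rw [pow_succ, ← mul_assoc, he, cs.simple_mul_simple_self]

/-- If `i` and `i'` are right descents of `w`, then `w` has reduced words ending with alternating
words in `i` and `i'` of all admissible lengths. -/
theorem exists_isReduced_append_alternatingWord {w : W} (k : ℕ) {i i' : B} (hne : i ≠ i')
    (hi : cs.IsRightDescent w i) (hi' : cs.IsRightDescent w i') (hk : M i i' = 0 ∨ k ≤ M i i') :
    ∃ v, cs.IsReduced (v ++ alternatingWord i i' k) ∧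
      w = cs.wordProd (v ++ alternatingWord i i' k) := by
  induction k generalizing i i' with
  | zero => simpa [alternatingWord] using cs.exists_isReduced w
  | succ k ih =>
    obtain ⟨v, hv, rfl⟩ := ih hne.symm hi' hi (by rw [M.symmetric i' i]; omega)
    -- Exchange deletes a letter of `v`, which makes room for a longer tail. Deletion inside the
    -- tail would make `s_{i'}` one of its inversions, against the order of the dihedral product.
    obtain ⟨j, hj, he⟩ := exists_eraseIdx_of_isRightDescent cs hi'
    rcases lt_or_ge j v.length with hjv | hjv
    · rw [List.eraseIdx_append_of_lt_length hjv] at he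
      have hw : cs.wordProd (v ++ alternatingWord i' i k) =
          cs.wordProd (v.eraseIdx j ++ alternatingWord i i' (k + 1)) := by
        rw [alternatingWord_succ, wordProd_append _ (v.eraseIdx j), wordProd_concat, ← mul_assoc,
          ← wordProd_append, ← he, simple_mul_simple_cancel_right]
      refine ⟨v.eraseIdx j, ?_, hw⟩
      have := List.length_eraseIdx_add_one hjv
      rw [CoxeterSystem.IsReduced, ← hw, hv.eq]
      simp only [List.length_append, length_alternatingWord]
      omega
    · exfalso
      rw [List.eraseIdx_append_of_length_le hjv, wordProd_append, wordProd_append, mul_assoc,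
        mul_right_inj, ← wordProd_mul_getD_rightInvSeq, mul_right_inj] at he
      have hj' : j - v.length < (cs.rightInvSeq (alternatingWord i' i k)).length := by
        simp only [List.length_append, length_alternatingWord, length_rightInvSeq] at hj ⊢
        omega
      rw [List.getD_eq_getElem _ 1 hj'] at he
      refine simple_notMem_rightInvSeq_alternatingWord cs hne.symm
        (k := k) (by rw [M.symmetric i' i]; omega) ?_
      rw [he]
      exact List.getElem_mem hj'

/-- **Matsumoto's theorem**: a map that respects the braid relations takes the same value on all
reduced words of an element. -/
theorem prod_map_eq_of_isReduced {G : Type*} [Monoid G] (f : B → G)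
    (hf : ∀ i i', M i i' ≠ 0 →
      ((braidWord M i i').map f).prod = ((braidWord M i' i).map f).prod)
    {ω ω' : List B} (hω : cs.IsReduced ω) (hω' : cs.IsReduced ω')
    (h : cs.wordProd ω = cs.wordProd ω') : (ω.map f).prod = (ω'.map f).prod := by
  obtain ⟨n, hn⟩ : ∃ n, ω.length = n := ⟨_, rfl⟩
  induction n using Nat.strong_induction_on generalizing ω ω' with
  | _ n ih =>
    have hlen : ω'.length = n := by rw [← hω'.eq, ← h, hω.eq, hn]
    -- Suffixes with equal values in `W` and under `f` can be stripped, leaving shorter prefixes for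
    -- the induction.
    have ih' : ∀ {u u' x x' : List B}, x ≠ [] → (u ++ x).length = n →
        cs.IsReduced (u ++ x) → cs.IsReduced (u' ++ x') → cs.wordProd (u ++ x) =
        cs.wordProd (u' ++ x') → cs.wordProd x = cs.wordProd x' → (x.map f).prod = (x'.map f).prod →
        ((u ++ x).map f).prod = ((u' ++ x').map f).prod := by
      intro u u' x x' hx hl hu hu' he hxx hfx
      have hu1 : cs.IsReduced u := by simpa using hu.take u.length
      have hu1' : cs.IsReduced u' := by simpa using hu'.take u'.length
      rw [wordProd_append, wordProd_append, hxx, mul_left_inj] at he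
      have hxl := List.length_pos_of_ne_nil hx
      rw [List.length_append] at hl
      rw [List.map_append, List.map_append, List.prod_append, List.prod_append, hfx,
        ih u.length (by omega) hu1 hu1' he rfl]
    rcases List.eq_nil_or_concat ω with rfl | ⟨u, i, rfl⟩
    · rw [List.length_nil] at hn
      rw [← hn, List.length_eq_zero_iff] at hlen
      rw [hlen]
    rcases List.eq_nil_or_concat ω' with rfl | ⟨u', i', rfl⟩
    · simp only [List.length_nil] at hlen
      simp only [← hlen, List.concat_eq_append, List.length_append, List.length_singleton] at hn
      omega
    have descent : ∀ {u : List B} {i : B}, cs.IsReduced (u.concat i) →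
        cs.IsRightDescent (cs.wordProd (u.concat i)) i := by
      intro u i hu
      rw [IsRightDescent, hu.eq, wordProd_concat, simple_mul_simple_cancel_right,
        List.length_concat]
      exact Nat.lt_succ_of_le (cs.length_wordProd_le u)
    by_cases hii : i = i'
    · subst hii
      rw [List.concat_eq_append] at hω hn h ⊢
      rw [List.concat_eq_append] at hω' h ⊢
      exact ih' (by simp) hn hω hω' h rfl rfl
    have hi := descent hω
    have hi' := descent hω'
    rw [← h] at hi'
    have hM : M i i' ≠ 0 := by
      intro h0
      obtain ⟨v, hv, hw⟩ :=
        exists_isReduced_append_alternatingWord cs (n + 1) hii hi hi' (Or.inl h0)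
      have := hv.eq
      rw [← hw, hω.eq, List.length_append, length_alternatingWord] at this
      omega
    obtain ⟨v, hv, hw⟩ :=
      exists_isReduced_append_alternatingWord cs (M i i') hii hi hi' (Or.inr le_rfl)
    obtain ⟨v', hv', hw'⟩ :=
      exists_isReduced_append_alternatingWord cs (M i' i) (Ne.symm hii) hi' hi (Or.inr le_rfl)
    have last : ∀ {a b : B} {u v : List B}, M a b ≠ 0 → cs.IsReduced (u.concat b) →
        cs.IsReduced (v ++ alternatingWord a b (M a b)) → (u.concat b).length = n →
        cs.wordProd (u.concat b) = cs.wordProd (v ++ alternatingWord a b (M a b)) →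
        ((u.concat b).map f).prod = ((v ++ alternatingWord a b (M a b)).map f).prod := by
      intro a b u v h0 hu hv hl he
      obtain ⟨m, hm⟩ := Nat.exists_eq_succ_of_ne_zero h0
      have e : v ++ alternatingWord a b (M a b) = (v ++ alternatingWord b a m) ++ [b] := by
        rw [hm, Nat.succ_eq_add_one, alternatingWord_succ, List.concat_eq_append,
          List.append_assoc]
      rw [e] at hv he ⊢
      rw [List.concat_eq_append] at hu hl he ⊢
      exact ih' (by simp) hl hu hv he rfl rfl
    have hMs : M i' i ≠ 0 := by rwa [M.symmetric i' i]
    rw [last hMs hω hv' hn hw', last hM hω' hv hlen (h.symm.trans hw)]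
    refine ih' ?_ ?_ hv' hv (hw'.symm.trans hw) (cs.wordProd_braidWord_eq i' i) (hf i' i hMs)
    · rw [← List.length_pos_iff, length_alternatingWord]; omega
    · rw [← hv'.eq, ← hw', hω.eq, hn]

end Matsumoto

end ArtinComplex

namespace ArtinComplex

open CoxeterSystem

/-! ### Special subgroups and their longest elements. -/

section Longest

variable {B : Type*} {W : Type*} [Group W] {M : CoxeterMatrix B} (cs : CoxeterSystem M W)

theorem simple_mem_specialSubgroup {T : Set B} {t : B} (ht : t ∈ T) :
    cs.simple t ∈ specialSubgroup cs T :=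
  Subgroup.subset_closure ⟨t, ht, rfl⟩

theorem wordProd_mem_specialSubgroup {T : Set B} {ω : List B} (h : ∀ i ∈ ω, i ∈ T) :
    cs.wordProd ω ∈ specialSubgroup cs T := by
  refine Subgroup.list_prod_mem _ fun x hx => ?_
  obtain ⟨i, hi, rfl⟩ := List.mem_map.mp hx
  exact simple_mem_specialSubgroup cs (h i hi)

theorem mem_specialSubgroup_of_mem_rightInvSeq {T : Set B} {ω : List B} (h : ∀ i ∈ ω, i ∈ T)
    {r : W} (hr : r ∈ cs.rightInvSeq ω) : r ∈ specialSubgroup cs T := by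
  induction ω with
  | nil => simp at hr
  | cons i ω ih =>
    have h' : ∀ i ∈ ω, i ∈ T := fun j hj => h j (List.mem_cons_of_mem _ hj)
    rw [rightInvSeq, List.mem_cons] at hr
    rcases hr with rfl | hr
    · have := wordProd_mem_specialSubgroup cs h'
      exact mul_mem (mul_mem (inv_mem this)
        (simple_mem_specialSubgroup cs (h i List.mem_cons_self))) this
    · exact ih h' hr

theorem exists_word_of_mem_specialSubgroup {T : Set B} {w : W} (hw : w ∈ specialSubgroup cs T) :
    ∃ ω : List B, (∀ i ∈ ω, i ∈ T) ∧ w = cs.wordProd ω := by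
  induction hw using Subgroup.closure_induction with
  | mem x hx =>
    obtain ⟨s, hs, rfl⟩ := hx
    exact ⟨[s], by simpa using hs, by simp⟩
  | one => exact ⟨[], by simp, by simp⟩
  | mul x y _ _ hx hy =>
    obtain ⟨ω, h, rfl⟩ := hx
    obtain ⟨ω', h', rfl⟩ := hy
    refine ⟨ω ++ ω', fun i hi => ?_, (cs.wordProd_append ω ω').symm⟩
    exact (List.mem_append.mp hi).elim (h i) (h' i)
  | inv x _ hx =>
    obtain ⟨ω, h, rfl⟩ := hx
    exact ⟨ω.reverse, fun i hi => h i (List.mem_reverse.mp hi), (cs.wordProd_reverse ω).symm⟩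

/-- Exchange only deletes letters, so reducing a word in `T` stays in `T`. -/
theorem exists_isReduced_of_word {T : Set B} (ω : List B) (h : ∀ i ∈ ω, i ∈ T) :
    ∃ ω' : List B, cs.IsReduced ω' ∧ (∀ i ∈ ω', i ∈ T) ∧ cs.wordProd ω = cs.wordProd ω' := by
  induction ω using List.reverseRecOn with
  | nil => exact ⟨[], by simp [CoxeterSystem.IsReduced], by simp, rfl⟩
  | append_singleton ω i ih =>
    obtain ⟨ω', hr, hT, he⟩ := ih fun j hj => h j (List.mem_append_left _ hj)
    rw [wordProd_append, he, wordProd_singleton]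
    by_cases hd : cs.IsRightDescent (cs.wordProd ω') i
    · obtain ⟨j, hj, hj'⟩ := exists_eraseIdx_of_isRightDescent cs hd
      refine ⟨ω'.eraseIdx j, ?_, fun k hk => hT k (List.mem_of_mem_eraseIdx hk), hj'⟩
      have h1 := cs.isRightDescent_iff.mp hd
      have h2 := List.length_eraseIdx_add_one hj
      rw [hr.eq] at h1
      rw [CoxeterSystem.IsReduced, ← hj']
      omega
    · refine ⟨ω' ++ [i], ?_, fun k hk => ?_, by simp [wordProd_append]⟩
      · have h1 := cs.not_isRightDescent_iff.mp hd
        rw [CoxeterSystem.IsReduced, wordProd_append, wordProd_singleton, h1, hr.eq]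
        simp
      · rcases List.mem_append.mp hk with hk | hk
        · exact hT k hk
        · exact h k (List.mem_append_right _ hk)

theorem exists_isReduced_of_mem_specialSubgroup {T : Set B} {w : W}
    (hw : w ∈ specialSubgroup cs T) :
    ∃ ω : List B, cs.IsReduced ω ∧ (∀ i ∈ ω, i ∈ T) ∧ w = cs.wordProd ω := by
  obtain ⟨ω, h, rfl⟩ := exists_word_of_mem_specialSubgroup cs hw
  exact exists_isReduced_of_word cs ω h

theorem IsLongest.isRightInversion {T : Set B} {w : W} (hw : IsLongest cs T w) {r : W}
    (hr : cs.IsReflection r) (hrT : r ∈ specialSubgroup cs T) : cs.IsRightInversion w r :=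
  ⟨hr, lt_of_le_of_ne (hw.2 _ (mul_mem hw.1 hrT)) (hr.length_mul_left_ne w)⟩

/-- Every reflection of `W_T` is an inversion of `w`. By the parity cocycle, a letter that lengthens
`x` therefore shortens `w * x`. -/
theorem IsLongest.length_mul_add {T : Set B} {w : W} (hw : IsLongest cs T w) {x : W}
    (hx : x ∈ specialSubgroup cs T) : cs.length (w * x) + cs.length x = cs.length w := by
  obtain ⟨ω, hω, hT, rfl⟩ := exists_isReduced_of_mem_specialSubgroup cs hx
  clear hx
  induction ω using List.reverseRecOn with
  | nil => simp
  | append_singleton ω i ih =>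
    have hω' : cs.IsReduced ω := by simpa using hω.take ω.length
    have hT' : ∀ j ∈ ω, j ∈ T := fun j hj => hT j (List.mem_append_left _ hj)
    have ih := ih hω' hT'
    have hx := wordProd_mem_specialSubgroup cs hT'
    have hi := simple_mem_specialSubgroup cs (hT i (by simp))
    have h1 : ¬ cs.IsRightInversion (cs.wordProd ω) (cs.simple i) := by
      rw [isRightInversion_simple_iff_isRightDescent, cs.not_isRightDescent_iff, hω'.eq]
      have := hω.eq
      rwa [wordProd_append, wordProd_singleton, List.length_append, List.length_singleton] at this
    have h2 := hw.isRightInversion cs ((cs.isReflection_simple i).conj (cs.wordProd ω))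
      (mul_mem (mul_mem hx hi) (inv_mem hx))
    rw [isRightInversion_iff_inversionParity cs (cs.isReflection_simple i)] at h1
    rw [isRightInversion_iff_inversionParity cs h2.1] at h2
    have hz : ∀ x : ZMod 2, x = 0 ∨ x = 1 := by decide
    have h3 : cs.IsRightInversion (w * cs.wordProd ω) (cs.simple i) := by
      rw [isRightInversion_iff_inversionParity cs (cs.isReflection_simple i),
        inversionParity_mul, h2, (hz _).resolve_right h1, zero_add]
    rw [isRightInversion_simple_iff_isRightDescent, cs.isRightDescent_iff] at h3
    have h4 := hω.eq
    rw [hω'.eq] at ih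
    rw [h4, wordProd_append, wordProd_singleton, ← mul_assoc, List.length_append,
      List.length_singleton]
    omega

theorem IsLongest.mul_self {T : Set B} {w : W} (hw : IsLongest cs T w) : w * w = 1 := by
  have := hw.length_mul_add cs hw.1
  rw [← cs.length_eq_zero_iff]
  omega

/-- The length formula, applied to `t` and to `t w⁻¹`, shows that `w t w⁻¹` has length 1. -/
theorem IsLongest.conj_simple {T : Set B} {w : W} (hw : IsLongest cs T w) {t : B} (ht : t ∈ T) :
    ∃ t' ∈ T, w * cs.simple t = cs.simple t' * w := by
  have hst := simple_mem_specialSubgroup cs ht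
  have h1 := hw.length_mul_add cs (mul_mem hst (inv_mem hw.1))
  have h2 := hw.length_mul_add cs hst
  have h3 : cs.length (cs.simple t * w⁻¹) = cs.length (w * cs.simple t) := by
    rw [← length_inv]; simp
  rw [cs.length_simple] at h2
  have h4 : cs.length (w * (cs.simple t * w⁻¹)) = 1 := by omega
  obtain ⟨ω, hω, hT, he⟩ :=
    exists_isReduced_of_mem_specialSubgroup cs (mul_mem hw.1 (mul_mem hst (inv_mem hw.1)))
  rw [he, hω.eq] at h4
  obtain ⟨t', rfl⟩ := List.length_eq_one_iff.mp h4
  refine ⟨t', hT t' (by simp), ?_⟩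
  rw [wordProd_singleton] at he
  rw [← he]
  group

end Longest

/-! ### Commutation of the elements `δ_T` over a nested set. -/

section ArtinGroup

variable {B : Type*} {W : Type*} [Group W] {M : CoxeterMatrix B} (cs : CoxeterSystem M W)

theorem artinGen_braid (s t : B) (h : M s t ≠ 0) :
    ((braidWord M s t).map (artinGen M)).prod = ((braidWord M t s).map (artinGen M)).prod := by
  have h1 : (PresentedGroup.mk (artinRelators M))
      (((braidWord M s t).map FreeGroup.of).prod *
        (((braidWord M t s).map FreeGroup.of).prod)⁻¹) = 1 :=
    PresentedGroup.one_of_mem ⟨s, t, h, rfl⟩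
  rw [map_mul, map_inv, mul_inv_eq_one, map_list_prod, map_list_prod, List.map_map,
    List.map_map] at h1
  exact h1

theorem artinGen_commute {s t : B} (h : M s t = 2) : Commute (artinGen M s) (artinGen M t) := by
  have := artinGen_braid (M := M) s t (by omega)
  rw [Commute, SemiconjBy]
  simpa [braidWord, h, M.symmetric t s, alternatingWord] using this

theorem artinLift_wordProd {ω : List B} (hω : cs.IsReduced ω) :
    artinLift cs (cs.wordProd ω) = (ω.map (artinGen M)).prod := by
  have h := (cs.exists_isReduced (cs.wordProd ω)).choose_spec
  exact prod_map_eq_of_isReduced cs _ artinGen_braid h.1 hω h.2.symm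

/-- The standard parabolic subgroup of the Artin group. -/
def parabolic (M : CoxeterMatrix B) (T : Set B) : Subgroup (ArtinGroup M) :=
  Subgroup.closure (artinGen M '' T)

theorem bigDelta_mem_parabolic {T : Set B} (hT : IsSpherical cs T) :
    bigDelta cs T ∈ parabolic M T := by
  obtain ⟨ω, hω, h, he⟩ := exists_isReduced_of_mem_specialSubgroup cs (longest_spec cs hT).1
  rw [bigDelta, he, artinLift_wordProd cs hω]
  refine Subgroup.list_prod_mem _ fun x hx => ?_
  obtain ⟨i, hi, rfl⟩ := List.mem_map.mp hx
  exact Subgroup.subset_closure ⟨i, h i hi, rfl⟩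

theorem smallDelta_mem_parabolic {T : Set B} (hT : IsSpherical cs T) :
    smallDelta cs T ∈ parabolic M T := by
  rw [smallDelta]
  split_ifs
  · exact bigDelta_mem_parabolic cs hT
  · exact pow_mem (bigDelta_mem_parabolic cs hT) 2

/-- If `ω` is a reduced word of `w_T t = t' w_T`, then `ω t` and `t' ω` are both reduced words of
`w_T`, so `Δ_T = a_ω a_t = a_{t'} a_ω`. -/
theorem bigDelta_mul_artinGen {T : Set B} (hT : IsSpherical cs T) {t t' : B} (ht : t ∈ T)
    (h : longest cs T * cs.simple t = cs.simple t' * longest cs T) :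
    bigDelta cs T * artinGen M t = artinGen M t' * bigDelta cs T := by
  have hw := longest_spec cs hT
  have hl := hw.length_mul_add cs (simple_mem_specialSubgroup cs ht)
  rw [cs.length_simple] at hl
  obtain ⟨ω, hω, he⟩ := cs.exists_isReduced (longest cs T * cs.simple t)
  rw [he, hω.eq] at hl
  have h1 : longest cs T = cs.wordProd (ω ++ [t]) := by
    rw [wordProd_append, ← he, wordProd_singleton, simple_mul_simple_cancel_right]
  have h2 : longest cs T = cs.wordProd (t' :: ω) := by
    rw [wordProd_cons, ← he, h, simple_mul_simple_cancel_left]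
  have r1 : cs.IsReduced (ω ++ [t]) := by
    rw [CoxeterSystem.IsReduced, ← h1, ← hl]; simp
  have r2 : cs.IsReduced (t' :: ω) := by
    rw [CoxeterSystem.IsReduced, ← h2, ← hl]; simp
  have e1 : bigDelta cs T = (ω.map (artinGen M)).prod * artinGen M t := by
    rw [bigDelta, h1, artinLift_wordProd cs r1]; simp
  have e2 : bigDelta cs T = artinGen M t' * (ω.map (artinGen M)).prod := by
    rw [bigDelta, h2, artinLift_wordProd cs r2]; simp
  conv_lhs => rw [e2]
  rw [e1, mul_assoc]

theorem smallDelta_commute_artinGen {T : Set B} (hT : IsSpherical cs T) {t : B} (ht : t ∈ T) :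
    Commute (smallDelta cs T) (artinGen M t) := by
  rw [smallDelta]
  split_ifs with h
  · exact bigDelta_mul_artinGen cs hT ht (by rw [← mul_inv_eq_iff_eq_mul, h t ht])
  · have hw := longest_spec cs hT
    obtain ⟨t', ht', h1⟩ := hw.conj_simple cs ht
    have h2 : longest cs T * cs.simple t' = cs.simple t * longest cs T := by
      have hs := hw.mul_self cs
      calc longest cs T * cs.simple t'
          = longest cs T * (cs.simple t' * longest cs T) * longest cs T := by
            rw [mul_assoc, mul_assoc, hs, mul_one]
        _ = cs.simple t * longest cs T := by
            rw [← h1, ← mul_assoc, hs, one_mul]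
    rw [Commute, SemiconjBy, pow_two, mul_assoc, bigDelta_mul_artinGen cs hT ht h1, ← mul_assoc,
      bigDelta_mul_artinGen cs hT ht' h2, mul_assoc]

theorem commute_of_mem_closure {G : Type*} [Group G] {S : Set G} {x : G}
    (h : ∀ y ∈ S, Commute x y) {g : G} (hg : g ∈ Subgroup.closure S) : Commute x g := by
  induction hg using Subgroup.closure_induction with
  | mem y hy => exact h y hy
  | one => exact Commute.one_right x
  | mul a b _ _ ha hb => exact ha.mul_right hb
  | inv a _ ha => exact ha.inv_right

theorem smallDelta_commute_of_subset {T T' : Set B} (hT : IsSpherical cs T)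
    (hT' : IsSpherical cs T') (h : T ⊆ T') : Commute (smallDelta cs T') (smallDelta cs T) := by
  refine commute_of_mem_closure ?_ (smallDelta_mem_parabolic cs hT)
  rintro _ ⟨t, ht, rfl⟩
  exact smallDelta_commute_artinGen cs hT' (h ht)

theorem smallDelta_commute_of_orthogonal {T T' : Set B} (hT : IsSpherical cs T)
    (hT' : IsSpherical cs T') (h : ∀ s ∈ T, ∀ t ∈ T', M s t = 2) :
    Commute (smallDelta cs T) (smallDelta cs T') := by
  refine commute_of_mem_closure ?_ (smallDelta_mem_parabolic cs hT')
  rintro _ ⟨t, ht, rfl⟩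
  refine (commute_of_mem_closure ?_ (smallDelta_mem_parabolic cs hT)).symm
  rintro _ ⟨s, hs, rfl⟩
  exact (artinGen_commute (h s hs t ht)).symm

theorem exists_component_superset {T U : Set B} (hT : ((diagram M).induce T).Connected)
    (hTU : T ⊆ U) : ∃ T₁ ∈ components M U, T ⊆ T₁ := by
  obtain ⟨x, hx⟩ := hT.nonempty
  refine ⟨_, ⟨((diagram M).induce U).connectedComponentMk ⟨x, hTU hx⟩, rfl⟩, fun y hy => ?_⟩
  refine ⟨⟨y, hTU hy⟩, ?_, rfl⟩
  rw [SimpleGraph.ConnectedComponent.mem_supp_iff, SimpleGraph.ConnectedComponent.eq]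
  exact (hT.preconnected ⟨y, hy⟩ ⟨x, hx⟩).map (SimpleGraph.induceHomOfLE (diagram M) hTU).toHom

theorem components_orthogonal {U T₁ T₂ : Set B} (h₁ : T₁ ∈ components M U)
    (h₂ : T₂ ∈ components M U) (hne : T₁ ≠ T₂) {s t : B} (hs : s ∈ T₁) (ht : t ∈ T₂) :
    M s t = 2 := by
  obtain ⟨c₁, rfl⟩ := h₁
  obtain ⟨c₂, rfl⟩ := h₂
  obtain ⟨s, hs, rfl⟩ := hs
  obtain ⟨t, ht, rfl⟩ := ht
  rw [SimpleGraph.ConnectedComponent.mem_supp_iff] at hs ht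
  by_contra h
  apply hne
  by_cases hst : s = t
  · rw [← hs, ← ht, hst]
  · have hadj : ((diagram M).induce U).Adj s t := ⟨fun h' => hst (Subtype.ext h'), h⟩
    rw [← hs, ← ht, SimpleGraph.ConnectedComponent.eq.mpr hadj.reachable]

theorem IsNested.subset_irreducibleSpherical {α : Set (Set B)} (hα : IsNested cs α) :
    α ⊆ irreducibleSpherical cs := by
  cases hα with
  | empty => exact Set.empty_subset _
  | step _ h _ _ _ => exact h

/-- Each member, being connected, lies in one component of the support. Distinct components are
orthogonal; a common component is a maximal member, so either it is one of the two sets or both lie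
strictly below it and induction applies. -/
theorem IsNested.subset_or_orthogonal {α : Set (Set B)} (hα : IsNested cs α) {T T' : Set B}
    (hT : T ∈ α) (hT' : T' ∈ α) :
    T ⊆ T' ∨ T' ⊆ T ∨ ∀ s ∈ T, ∀ t ∈ T', M s t = 2 := by
  induction hα with
  | empty => exact hT.elim
  | step α hsub _ hdec _ ih =>
    obtain ⟨T₁, hT₁, h₁⟩ :=
      exists_component_superset (hsub hT).2.2 (Set.subset_sUnion_of_mem hT : T ⊆ support α)
    obtain ⟨T₂, hT₂, h₂⟩ :=
      exists_component_superset (hsub hT').2.2 (Set.subset_sUnion_of_mem hT' : T' ⊆ support α)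
    by_cases hne : T₁ = T₂
    · subst hne
      have hmax : Maximal (fun T' => T' ∈ α) T₁ := by
        have : T₁ ∈ components M (support α) := hT₁
        rwa [← hdec] at this
      rcases h₁.eq_or_ssubset with rfl | h₁
      · exact Or.inr (Or.inl h₂)
      rcases h₂.eq_or_ssubset with rfl | h₂
      · exact Or.inl h₁.subset
      exact ih T₁ hmax ⟨hT, h₁⟩ ⟨hT', h₂⟩
    · exact Or.inr (Or.inr fun s hs t ht => components_orthogonal hT₁ hT₂ hne (h₁ hs) (h₂ ht))

theorem IsNested.smallDelta_commute {α : Set (Set B)} (hα : IsNested cs α) {T T' : Set B}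
    (hT : T ∈ α) (hT' : T' ∈ α) : Commute (smallDelta cs T) (smallDelta cs T') := by
  have hs := (hα.subset_irreducibleSpherical cs hT).2.1
  have hs' := (hα.subset_irreducibleSpherical cs hT').2.1
  rcases hα.subset_or_orthogonal cs hT hT' with h | h | h
  · exact (smallDelta_commute_of_subset cs hs hs' h).symm
  · exact smallDelta_commute_of_subset cs hs' hs h
  · exact smallDelta_commute_of_orthogonal cs hs hs' h

end ArtinGroup

end ArtinComplex

namespace ArtinComplex

open CoxeterSystem

/-! ### Translations of fibres by products of commuting elements. -/

section Translations

/-- `φ g` translates the fibre `{x} × ℤ` by `c`. -/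
def Translates {G X : Type*} [Group G] (φ : G →* Equiv.Perm (X × ℤ)) (x : X) (g : G) (c : ℤ) :
    Prop :=
  ∀ n, φ g (x, n) = (x, n + c)

variable {G X : Type*} [Group G] {φ : G →* Equiv.Perm (X × ℤ)} {x : X}

theorem Translates.one : Translates φ x 1 0 := by
  intro n; simp

theorem Translates.mul {g h : G} {c d : ℤ} (hg : Translates φ x g c) (hh : Translates φ x h d) :
    Translates φ x (g * h) (c + d) := by
  intro n; rw [map_mul, Equiv.Perm.mul_apply, hh, hg]; congr 1; ring

theorem Translates.inv {g : G} {c : ℤ} (hg : Translates φ x g c) : Translates φ x g⁻¹ (-c) := by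
  intro n
  rw [map_inv, Equiv.Perm.inv_eq_iff_eq, hg]
  congr 1; ring

theorem Translates.zpow {g : G} {c : ℤ} (hg : Translates φ x g c) (k : ℤ) :
    Translates φ x (g ^ k) (k * c) := by
  induction k with
  | zero => simpa using Translates.one
  | succ k ih =>
    rw [zpow_add_one, add_mul, one_mul]
    exact ih.mul hg
  | pred k ih =>
    rw [zpow_sub_one, sub_mul, one_mul, sub_eq_add_neg]
    exact ih.mul hg.inv

theorem Translates.unique {g : G} {c d : ℤ} (hc : Translates φ x g c) (hd : Translates φ x g d) :
    c = d := by
  have := (hc 0).symm.trans (hd 0)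
  simpa using this

open scoped IsMulCommutative in
/-- An element of a subgroup that is generated by commuting elements `f i` is a product of powers
of these. The exponents determine how its square translates fibres. -/
theorem exists_exponents_of_mem_closure {ι : Type*} {f : ι → G} {s : Set ι}
    (hcomm : ∀ i ∈ s, ∀ j ∈ s, Commute (f i) (f j)) {g : G}
    (hg : g ∈ Subgroup.closure (f '' s)) :
    ∃ a : ι →₀ ℤ, (a.support : Set ι) ⊆ s ∧ g ∈ Subgroup.closure (f '' a.support) ∧
      ∀ (x : X) (κ : ι → ℤ), (∀ i ∈ s, Translates φ x (f i ^ 2) (κ i)) →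
        Translates φ x (g ^ 2) (a.sum fun i k => k * κ i) := by
  classical
  have : IsMulCommutative (Subgroup.closure (f '' s)) := by
    apply Subgroup.isMulCommutative_closure
    rintro _ ⟨i, hi, rfl⟩ _ ⟨j, hj, rfl⟩
    exact hcomm i hi j hj
  let F : s → Subgroup.closure (f '' s) := fun i =>
    ⟨f i, Subgroup.subset_closure ⟨i, i.2, rfl⟩⟩
  have hF : Subgroup.closure (Set.range F) = ⊤ := by
    rw [← Subgroup.closure_closure_coe_preimage (k := f '' s)]
    congr 1
    ext y
    constructor
    · rintro ⟨i, rfl⟩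
      exact ⟨i, i.2, rfl⟩
    · rintro ⟨i, hi, he⟩
      exact ⟨⟨i, hi⟩, Subtype.ext he⟩
  obtain ⟨a, ha⟩ := Subgroup.exists_finsupp_of_mem_closure_range F ⟨g, hg⟩ (by rw [hF]; trivial)
  have hsupp : ((a.mapDomain Subtype.val).support : Set ι) = Subtype.val '' (a.support : Set s) := by
    rw [Finsupp.mapDomain_support_of_injective Subtype.val_injective, Finset.coe_image]
  have hga : g = ((a.prod fun i k => F i ^ k : Subgroup.closure (f '' s)) : G) :=
    congrArg Subtype.val ha
  refine ⟨a.mapDomain Subtype.val, ?_, ?_, fun x κ hκ => ?_⟩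
  · rw [hsupp]
    rintro _ ⟨i, -, rfl⟩
    exact i.2
  · rw [hga, hsupp]
    have : (a.prod fun i k => F i ^ k) ∈ (Subgroup.closure
        (f '' (Subtype.val '' (a.support : Set s)))).comap (Subgroup.closure (f '' s)).subtype := by
      refine Subgroup.prod_mem _ fun i hi => Subgroup.zpow_mem _ ?_ _
      exact Subgroup.subset_closure ⟨i, ⟨i, hi, rfl⟩, rfl⟩
    exact this
  · rw [Finsupp.sum_mapDomain_index_inj Subtype.val_injective, hga, ← Subgroup.coe_pow,
      Finsupp.prod, ← Finset.prod_pow, Finsupp.sum]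
    induction a.support using Finset.induction_on with
    | empty => simpa using Translates.one
    | insert i t hi ih =>
      rw [Finset.prod_insert hi, Finset.sum_insert hi, Subgroup.coe_mul]
      refine Translates.mul ?_ ih
      rw [← zpow_natCast, zpow_comm, zpow_natCast]
      exact (hκ i i.2).zpow (a i)

end Translations

/-! ### Crossing numbers of `Δ_T` and independence of indicators. -/

section Crossing

variable {B : Type*} {W : Type*} [Group W] {M : CoxeterMatrix B} (cs : CoxeterSystem M W)

/-- The action of the Artin group on `W × ℤ` by conjugation in the first coordinate and by
counting crossings in the second one. -/
noncomputable def crossingAction : ArtinGroup M →* Equiv.Perm (W × ℤ) :=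
  PresentedGroup.toGroup (f := crossingPerm cs ℤ) (by
    rintro _ ⟨s, t, -, rfl⟩
    rw [map_mul, map_inv, mul_inv_eq_one, map_list_prod, map_list_prod, List.map_map,
      List.map_map]
    simpa [Function.comp_def] using crossingPerm_braid cs ℤ s t)

theorem crossingAction_prod (ω : List B) :
    crossingAction cs (ω.map (artinGen M)).prod = (ω.map (crossingPerm cs ℤ)).prod := by
  rw [map_list_prod, List.map_map]
  rfl

-- The inversion sequence of a reduced word of `w_T` has no repetitions and consists of the
-- reflections of `W_T`, all of which are inversions of `w_T`.
open Classical in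
theorem crossingAction_bigDelta {T : Set B} (hT : IsSpherical cs T) {r : W}
    (hr : cs.IsReflection r) (n : ℤ) :
    crossingAction cs (bigDelta cs T) (r, n) =
      (longest cs T * r * (longest cs T)⁻¹,
        n + if r ∈ specialSubgroup cs T then 1 else 0) := by
  have hw := longest_spec cs hT
  obtain ⟨ω, hω, h, he⟩ := exists_isReduced_of_mem_specialSubgroup cs hw.1
  have hmem : r ∈ cs.rightInvSeq ω ↔ r ∈ specialSubgroup cs T := by
    refine ⟨mem_specialSubgroup_of_mem_rightInvSeq cs h, fun hrT => ?_⟩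
    rw [mem_rightInvSeq_iff cs hω, ← he]
    exact hw.isRightInversion cs hr hrT
  rw [bigDelta, he, artinLift_wordProd cs hω, crossingAction_prod, crossingPerm_prod_apply]
  congr 2
  split_ifs with hrT
  · rw [List.count_eq_one_of_mem hω.nodup_rightInvSeq (hmem.mpr hrT), Nat.cast_one]
  · rw [List.count_eq_zero_of_not_mem (mt hmem.mp hrT), Nat.cast_zero]

open Classical in
theorem translates_bigDelta_sq {T : Set B} (hT : IsSpherical cs T) {r : W}
    (hr : cs.IsReflection r) :
    Translates (crossingAction cs) r (bigDelta cs T ^ 2)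
      (if r ∈ specialSubgroup cs T then 2 else 0) := by
  intro n
  have hw := longest_spec cs hT
  have hinv : (longest cs T)⁻¹ = longest cs T := inv_eq_of_mul_eq_one_left (hw.mul_self cs)
  have hiff : longest cs T * r * (longest cs T)⁻¹ ∈ specialSubgroup cs T ↔
      r ∈ specialSubgroup cs T := by
    rw [Subgroup.mul_mem_cancel_right _ (inv_mem hw.1), Subgroup.mul_mem_cancel_left _ hw.1]
  rw [pow_two, map_mul, Equiv.Perm.mul_apply, crossingAction_bigDelta cs hT hr,
    crossingAction_bigDelta cs hT (hr.conj _)]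
  simp only [hiff]
  congr 1
  · rw [hinv]
    have := hw.mul_self cs
    calc _ = (longest cs T * longest cs T) * r * (longest cs T * longest cs T) := by group
      _ = r := by rw [this]; simp
  · split_ifs <;> ring

-- The constant is produced before sphericity is assumed, so that one nonvanishing function `κ` can
-- be chosen on all subsets.
open Classical in
theorem exists_translates_smallDelta_sq (T : Set B) :
    ∃ k : ℤ, k ≠ 0 ∧ (IsSpherical cs T → ∀ r, cs.IsReflection r →
      Translates (crossingAction cs) r (smallDelta cs T ^ 2)
        (if r ∈ specialSubgroup cs T then k else 0)) := by
  by_cases h : ∀ t ∈ T, longest cs T * cs.simple t * (longest cs T)⁻¹ = cs.simple t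
  · refine ⟨2, two_ne_zero, fun hT r hr => ?_⟩
    rw [smallDelta, if_pos h]
    exact translates_bigDelta_sq cs hT hr
  · refine ⟨4, by norm_num, fun hT r hr => ?_⟩
    have := translates_bigDelta_sq cs hT hr
    rw [smallDelta, if_neg h, pow_two (bigDelta cs T ^ 2)]
    convert this.mul this using 1
    split_ifs <;> norm_num

theorem IsSpherical.finite {T : Set B} (hT : IsSpherical cs T) : T.Finite :=
  (Set.Finite.preimage (simple_injective cs).injOn hT).subset
    fun _ ht => simple_mem_specialSubgroup cs ht

open Classical in
/-- The indicator functions of the sets of reflections in `W_T`, for `T` irreducible and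
spherical, are linearly independent. -/
theorem eq_zero_of_sum_indicator {κ : Set B → ℤ} (hκ : ∀ T, κ T ≠ 0) {d : Set B →₀ ℤ}
    (hd : (d.support : Set (Set B)) ⊆ irreducibleSpherical cs)
    (h : ∀ r, cs.IsReflection r →
      (d.sum fun T k => k * if r ∈ specialSubgroup cs T then κ T else 0) = 0) : d = 0 := by
  by_contra hne
  -- At a reflection of full support in a maximal `T`, any other contributing `T'` would contain
  -- `T`, so only the term of `T` remains.
  obtain ⟨T, hT, hmax⟩ := Finset.exists_maximal (Finsupp.support_nonempty_iff.mpr hne)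
  obtain ⟨-, hsph, hconn⟩ := hd hT
  obtain ⟨r, hrT, hr, hmin⟩ := exists_isReflection_full_support cs (hsph.finite cs) hconn
  have hsum := h r hr
  rw [Finsupp.sum, Finset.sum_eq_single T] at hsum
  · rw [if_pos hrT] at hsum
    exact mul_ne_zero (Finsupp.mem_support_iff.mp hT) (hκ T) hsum
  · intro T' hT' hTT'
    rw [if_neg, mul_zero]
    intro hrT'
    exact hTT' ((hmax hT' (hmin T' hrT')).antisymm (hmin T' hrT'))
  · intro hT'
    exact absurd hT hT'

end Crossing

end ArtinComplex

theorem lemma2p6 {B : Type*} {W : Type*} [Group W] {M : CoxeterMatrix B}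
    (cs : CoxeterSystem M W) (α β : Set (Set B))
    (hα : α ∈ ArtinComplex.oslashSimplices cs) (hβ : β ∈ ArtinComplex.oslashSimplices cs) :
    ArtinComplex.standardAbelian cs α ⊓ ArtinComplex.standardAbelian cs β =
      ArtinComplex.standardAbelian cs (α ∩ β) := by
  classical
  open ArtinComplex in
  have hα' : IsNested cs α := hα
  have hβ' : IsNested cs β := hβ
  refine le_antisymm ?_ (le_inf (Subgroup.closure_mono (Set.image_mono Set.inter_subset_left))
    (Subgroup.closure_mono (Set.image_mono Set.inter_subset_right)))
  rintro g ⟨hgα, hgβ⟩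
  obtain ⟨a, haα, hga, ha⟩ := exists_exponents_of_mem_closure (φ := crossingAction cs)
    (fun _ hT _ hT' => hα'.smallDelta_commute cs hT hT') hgα
  obtain ⟨b, hbβ, -, hb⟩ := exists_exponents_of_mem_closure (φ := crossingAction cs)
    (fun _ hT _ hT' => hβ'.smallDelta_commute cs hT hT') hgβ
  have hsα := hα'.subset_irreducibleSpherical cs
  have hsβ := hβ'.subset_irreducibleSpherical cs
  choose κ hκ hκt using exists_translates_smallDelta_sq cs
  have hab : a = b := by
    -- Exponents are compared over all of `S_⊘`, since `α ∪ β` need not be nested.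
    rw [← sub_eq_zero]
    refine eq_zero_of_sum_indicator cs hκ ?_ fun r hr => ?_
    · intro T hT
      rcases Finset.mem_union.mp (Finsupp.support_sub hT) with hT | hT
      · exact hsα (haα hT)
      · exact hsβ (hbβ hT)
    · rw [Finsupp.sum_sub_index fun _ _ _ => sub_mul _ _ _, sub_eq_zero]
      exact (ha r _ fun T hT => hκt T (hsα hT).2.1 r hr).unique
        (hb r _ fun T hT => hκt T (hsβ hT).2.1 r hr)
  refine Subgroup.closure_mono (Set.image_mono (Set.subset_inter haα ?_)) hga
  rw [hab]
  exact hbβ
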